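/- All graphs are finite, simple and undirected. For a vertex $v$ of a graph $G$ let $G_v$ be the graph obtained from $G$ by deleting $v$ and all edges incident to it. A graph $H$ is a \emph{reconstruction} of $G$ if $V(H)=V(G)$ and $H_v\cong G_v$ for every $v\in V(G)$; the graph $G$ is \emph{reconstructible} if every reconstruction of $G$ is isomorphic to $G$. For each of the following families there is an $N\in\mathbb{N}$ such that the indicated graph is reconstructible for every $n\ge N$: 1. the clique $K_n$; 2. the ladder $L_n=P_n\,\square\,K_2$, where $P_n$ is the path on $n$ vertices; 3. the book graph $K_{1,n}\,\square\,K_2$; 4. the gear graph on $2n+1$ vertices, i.e. a cycle of length $2n$ together with a central vertex joined to every second vertex of the cycle; 5. the prism graph $C_n\,\square\,K_2$; 6. the antiprism graph on $2n$ vertices, i.e. two disjoint cycles $u_0\dots u_{n-1}$ and $w_0\dots w_{n-1}$ together with the edges $u_iw_i$ and $u_iw_{i+1}$ (indices modulo $n$); 7. the Möbius graph (Möbius ladder) on $2n$ vertices, i.e. a cycle of length $2n$ together with all edges joining antipodal vertices; 8. the crossed-prism graph on $4n$ vertices, i.e. two disjoint cycles $u_0\dots u_{2n-1}$ and $w_0\dots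 w_{2n-1}$ together with the edges $u_{2k}w_{2k+1}$ and $u_{2k+1}w_{2k}$ for $0\le k<n$. Moreover, there is an $N\in\mathbb{N}$ such that, for all $n_1,n_2\in\mathbb{N}$ with $n_1n_2\ge N$, the grid $G_{n_1\times n_2}=P_{n_1}\,\square\,P_{n_2}$ is reconstructible. -/

import Mathlib

/-- `H` is a reconstruction of `G`: both graphs have the same vertex set and, for every vertex `v`,
the vertex-deleted subgraphs `G_v` and `H_v` are isomorphic. -/
def IsReconstruction {V : Type*} (H G : SimpleGraph V) : Prop :=
  ∀ v : V, Nonempty (G.induce {u | u ≠ v} ≃g H.induce {u | u ≠ v})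

/-- `G` is reconstructible: every reconstruction of `G` is isomorphic to `G`. -/
def Reconstructible {V : Type*} (G : SimpleGraph V) : Prop :=
  ∀ H : SimpleGraph V, IsReconstruction H G → Nonempty (G ≃g H)

/-- The clique `K_n` on `n` vertices. -/
def cliqueGraph (n : ℕ) : SimpleGraph (Fin n) := SimpleGraph.completeGraph (Fin n)

/-- The grid `G_{n₁ × n₂}`, with `n₁ n₂` vertices: the Cartesian product of two paths. -/
def gridGraph (n₁ n₂ : ℕ) : SimpleGraph (Fin n₁ × Fin n₂) :=
  (SimpleGraph.pathGraph n₁).boxProd (SimpleGraph.pathGraph n₂)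

/-- The ladder `L_n` with `n` rungs, the Cartesian product of a path on `n` vertices and `K₂`. -/
def ladderGraph (n : ℕ) : SimpleGraph (Fin n × Fin 2) :=
  (SimpleGraph.pathGraph n).boxProd (SimpleGraph.completeGraph (Fin 2))

/-- The book graph with `n` quadrilateral pages: the Cartesian product of the star `K_{1,n}`
and `K₂`. -/
def bookGraph (n : ℕ) : SimpleGraph ((Fin 1 ⊕ Fin n) × Fin 2) :=
  (completeBipartiteGraph (Fin 1) (Fin n)).boxProd (SimpleGraph.completeGraph (Fin 2))

/-- The gear graph with `2n + 1` vertices: the rim is a cycle of length `2n`, and the centre `none`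
is joined to every second vertex of the rim (here, those of even index). -/
def gearGraph (n : ℕ) : SimpleGraph (Option (Fin (2 * n))) :=
  (SimpleGraph.cycleGraph (2 * n)).map Function.Embedding.some ⊔
    SimpleGraph.fromRel (fun a b => a = none ∧ ∃ i : Fin (2 * n), b = some i ∧ Even i.val)

/-- The prism graph with `2n` vertices: the Cartesian product of the cycle `C_n` and `K₂`. -/
def prismGraph (n : ℕ) : SimpleGraph (Fin n × Fin 2) :=
  (SimpleGraph.cycleGraph n).boxProd (SimpleGraph.completeGraph (Fin 2))

/-- The antiprism graph with `2n` vertices: two disjoint cycles `u_0 … u_{n-1}` and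
`w_0 … w_{n-1}`, with each `u_i` joined to `w_i` and to `w_{i+1}` (indices modulo `n`). -/
def antiprismGraph (n : ℕ) : SimpleGraph (Fin n ⊕ Fin n) :=
  SimpleGraph.sum (SimpleGraph.cycleGraph n) (SimpleGraph.cycleGraph n) ⊔
    SimpleGraph.fromRel (fun a b => ∃ i j : Fin n, a = Sum.inl i ∧ b = Sum.inr j ∧
      (j.val = i.val ∨ j.val = (i.val + 1) % n))

/-- The Möbius ladder with `2n` vertices: a cycle of length `2n` in which each vertex is joined to
the antipodal one. -/
def mobiusGraph (n : ℕ) : SimpleGraph (Fin (2 * n)) :=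
  SimpleGraph.cycleGraph (2 * n) ⊔ SimpleGraph.fromRel (fun i j => j.val = i.val + n)

/-- The crossed prism graph with `4n` vertices: two disjoint cycles `u_0 … u_{2n-1}` and
`w_0 … w_{2n-1}` of even length `2n`, with `u_{2k}` joined to `w_{2k+1}` and `u_{2k+1}` joined to
`w_{2k}`, for `0 ≤ k < n`. -/
def crossedPrismGraph (n : ℕ) : SimpleGraph (Fin (2 * n) ⊕ Fin (2 * n)) :=
  SimpleGraph.sum (SimpleGraph.cycleGraph (2 * n)) (SimpleGraph.cycleGraph (2 * n)) ⊔
    SimpleGraph.fromRel (fun a b => ∃ i j : Fin (2 * n), a = Sum.inl i ∧ b = Sum.inr j ∧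
      ∃ k : ℕ, (i.val = 2 * k ∧ j.val = 2 * k + 1) ∨ (i.val = 2 * k + 1 ∧ j.val = 2 * k))

/-! Counting edges shows that the deck fixes the degree of every vertex, and then the degrees of the
neighbors of every vertex (`IsReconstruction.deg_eq`, `IsReconstruction.exists_adj_deg_iff`). Fix
`v` and transport a reconstruction `H` so that it agrees with `G` off `v`
(`Reconstructible.of_extension`); only the neighbors of `v` are then in doubt. If `H` misses a
`G`-neighbor `u` of `v`, then `u` has degree one less in `H`, and that value must be the `G`-degree
of some vertex other than `v`.

For regular graphs, books and gears this is already absurd, since no two relevant degrees are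
consecutive. Ladders and larger grids, with `v` a corner, also need neighbor degrees. For paths `v`
may be reattached at the other end, which still gives a path. -/

namespace SimpleGraph

/-- The degree of a vertex, as the cardinality of its neighbor set, free of instance arguments. -/
noncomputable def deg {V : Type*} (G : SimpleGraph V) (v : V) : ℕ := (G.neighborSet v).ncard

theorem deg_eq_degree {V : Type*} (G : SimpleGraph V) (v : V) [Fintype (G.neighborSet v)] :
    G.deg v = G.degree v := by
  rw [deg, ← card_neighborSet_eq_degree, Set.ncard_eq_toFinset_card', Set.toFinset_card]

theorem deg_eq_card {V : Type*} {G : SimpleGraph V} {v : V} {s : Finset V}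
    (h : ∀ u, G.Adj v u ↔ u ∈ s) : G.deg v = s.card := by
  rw [deg, ← Set.ncard_coe_finset]
  congr 1
  ext u
  simp [h]

theorem Iso.deg_eq {V W : Type*} {G : SimpleGraph V} {H : SimpleGraph W} (f : G ≃g H) (v : V) :
    H.deg (f v) = G.deg v := by
  rw [deg, deg, ← Set.ncard_image_of_injective _ f.injective]
  congr 1
  ext u
  constructor
  · intro h
    refine ⟨f.symm u, ?_, by simp⟩
    rw [mem_neighborSet, ← f.map_adj_iff]
    simpa using h
  · rintro ⟨w, hw, rfl⟩
    exact f.map_adj_iff.mpr hw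

open Classical in
theorem deg_induce_ne {V : Type*} [Finite V] (G : SimpleGraph V) (v : V) (u : {u | u ≠ v}) :
    (G.induce {u | u ≠ v}).deg u + (if G.Adj v u then 1 else 0) = G.deg u := by
  have h1 : (G.induce {u | u ≠ v}).deg u = (G.neighborSet u \ {v}).ncard := by
    rw [deg, ← Set.ncard_image_of_injective _ Subtype.val_injective]
    congr 1
    ext w
    simp [and_comm]
  rw [h1, deg]
  split_ifs with h
  · exact Set.ncard_sdiff_singleton_add_one (by simpa using h.symm)
  · rw [Set.sdiff_singleton_eq_self (by simpa using fun h' => h h'.symm), add_zero]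

theorem sum_ne {V M : Type*} [Fintype V] [AddCommMonoid M] (v : V) [Fintype {u | u ≠ v}]
    (f : V → M) : ∑ u, f u = f v + ∑ u : {u | u ≠ v}, f u := by
  classical
  rw [← Finset.add_sum_erase _ _ (Finset.mem_univ v)]
  congr 1
  rw [← Finset.sum_subtype]
  simp

open Classical in
theorem sum_ite_adj {V : Type*} [Fintype V] (G : SimpleGraph V) (v : V) :
    ∑ u, (if G.Adj v u then 1 else 0) = G.deg v := by
  rw [← Finset.card_filter]
  exact (deg_eq_card (by simp)).symm

-- Deleting `v` loses `deg v` at `v` itself and one more at each of its neighbors.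
open Classical in
theorem sum_deg_induce_ne {V : Type*} [Fintype V] (G : SimpleGraph V) (v : V) :
    ∑ u, (G.induce {u | u ≠ v}).deg u + 2 * G.deg v = ∑ u, G.deg u := by
  rw [sum_ne v G.deg]
  simp_rw [← deg_induce_ne G v]
  rw [Finset.sum_add_distrib]
  have := sum_ne v (fun u => if G.Adj v u then 1 else 0)
  rw [sum_ite_adj] at this
  simp only [SimpleGraph.irrefl, if_false, zero_add] at this
  rw [← this]
  ring

theorem sum_deg_iso {V W : Type*} [Fintype V] [Fintype W] {G : SimpleGraph V} {H : SimpleGraph W}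
    (f : G ≃g H) : ∑ v, G.deg v = ∑ w, H.deg w :=
  Fintype.sum_equiv f.toEquiv _ _ fun v => (f.deg_eq v).symm

end SimpleGraph

open SimpleGraph

/-! ### Invariants determined by the deck -/

theorem IsReconstruction.sum_deg_eq {V : Type*} [Fintype V] {G H : SimpleGraph V}
    (h : IsReconstruction H G) (hV : 3 ≤ Fintype.card V) : ∑ v, H.deg v = ∑ v, G.deg v := by
  classical
  have key (K : SimpleGraph V) : ∑ v, ∑ u, (K.induce {u | u ≠ v}).deg u + 2 * ∑ v, K.deg v
      = Fintype.card V * ∑ v, K.deg v := by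
    rw [Finset.mul_sum, ← Finset.sum_add_distrib, Finset.sum_congr rfl
      fun v _ => sum_deg_induce_ne K v]
    simp
  have e : ∑ v, ∑ u, (H.induce {u | u ≠ v}).deg u = ∑ v, ∑ u, (G.induce {u | u ≠ v}).deg u :=
    Finset.sum_congr rfl fun v _ => (sum_deg_iso (h v).some).symm
  have kG := key G
  have kH := key H
  rw [e] at kH
  obtain ⟨m, hm⟩ := Nat.exists_eq_add_of_le hV
  rw [hm] at kG kH
  -- The factor is `|V| - 2`: each edge survives in all cards but two. It is nonzero because `|V| ≥
  -- 3`.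
  have : (1 + m) * ∑ v, H.deg v = (1 + m) * ∑ v, G.deg v := by linarith
  exact Nat.eq_of_mul_eq_mul_left (by omega) this

theorem IsReconstruction.deg_eq {V : Type*} [Fintype V] {G H : SimpleGraph V}
    (h : IsReconstruction H G) (hV : 3 ≤ Fintype.card V) (v : V) : H.deg v = G.deg v := by
  classical
  have kG := sum_deg_induce_ne G v
  have kH := sum_deg_induce_ne H v
  rw [h.sum_deg_eq hV, ← sum_deg_iso (h v).some] at kH
  omega

-- Partial sums of `g` telescope: passing from the degree of `u` in the card to its degree in `G`
-- adds the single term `g (G.deg u)`, exactly when `u` is adjacent to `v`. Hence the sum of `g`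
-- over neighbor degrees depends only on the card and the degrees.
open Classical in
theorem SimpleGraph.sum_neighbor_deg {V : Type*} [Fintype V] (G : SimpleGraph V) (g : ℕ → ℕ)
    (v : V) :
    ∑ u, (∑ j ∈ Finset.range ((G.induce {u | u ≠ v}).deg u + 1), g j) +
      ∑ u, (if G.Adj v u then g (G.deg u) else 0) =
    ∑ u : {u | u ≠ v}, ∑ j ∈ Finset.range (G.deg u + 1), g j := by
  rw [sum_ne v (fun u => if G.Adj v u then g (G.deg u) else 0)]
  simp only [SimpleGraph.irrefl, if_false, zero_add]
  rw [← Finset.sum_add_distrib]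
  refine Finset.sum_congr rfl fun u _ => ?_
  rw [← deg_induce_ne G v u]
  split_ifs
  · rw [Finset.sum_range_succ _ ((G.induce {u | u ≠ v}).deg u + 1)]
  · rfl

/-- The multiset of neighbor degrees of a vertex is determined by the deck. -/
theorem IsReconstruction.exists_adj_deg_iff {V : Type*} [Fintype V] {G H : SimpleGraph V}
    (h : IsReconstruction H G) (hV : 3 ≤ Fintype.card V) (v : V) (p : ℕ → Prop) :
    (∃ u, H.Adj v u ∧ p (H.deg u)) ↔ ∃ u, G.Adj v u ∧ p (G.deg u) := by
  classical
  let g : ℕ → ℕ := fun j => if p j then 1 else 0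
  have kG := sum_neighbor_deg G g v
  have kH := sum_neighbor_deg H g v
  simp_rw [h.deg_eq hV] at kH ⊢
  rw [← kG, ← Fintype.sum_equiv (h v).some.toEquiv _ _
    (fun u => congrArg (fun d => ∑ j ∈ Finset.range (d + 1), g j) ((h v).some.deg_eq u).symm)] at kH
  have e := Nat.add_left_cancel kH
  have key (K : SimpleGraph V) : (∃ u, K.Adj v u ∧ p (G.deg u)) ↔
      ∑ u, (if K.Adj v u then g (G.deg u) else 0) ≠ 0 := by
    simp [g]
  rw [key, key, e]

/-! ### Extending a card back to the graph -/

/-- A graph is reconstructible as soon as, for one vertex `v`, every way of adding `v` back to `G_v`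
compatible with the degrees and the neighbor degrees gives a graph isomorphic to `G`. -/
theorem Reconstructible.of_extension {V : Type*} [Fintype V] {G : SimpleGraph V}
    (hV : 3 ≤ Fintype.card V) (v : V)
    (h : ∀ H : SimpleGraph V, (∀ a b, a ≠ v → b ≠ v → (H.Adj a b ↔ G.Adj a b)) →
      H.deg v = G.deg v →
      (∀ u, u ≠ v → ∃ w, w ≠ v ∧ H.deg u = G.deg w ∧ ∀ p : ℕ → Prop,
        (∃ x, H.Adj u x ∧ p (H.deg x)) ↔ ∃ x, G.Adj w x ∧ p (G.deg x)) →
      Nonempty (G ≃g H)) : Reconstructible G := by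
  classical
  intro H hH
  obtain ⟨f⟩ := hH v
  -- The isomorphism of cards, extended by fixing `v`; pulling `H` back along it makes the two
  -- graphs agree off `v`.
  let e : V ≃ V :=
    { toFun := fun u => if hu : u ≠ v then f ⟨u, hu⟩ else v
      invFun := fun u => if hu : u ≠ v then f.symm ⟨u, hu⟩ else v
      left_inv := by
        intro u
        by_cases hu : u = v
        · simp [hu]
        · have : (f ⟨u, hu⟩).1 ≠ v := (f ⟨u, hu⟩).2
          simp [hu, this]
      right_inv := by
        intro u
        by_cases hu : u = v
        · simp [hu]
        · have : (f.symm ⟨u, hu⟩).1 ≠ v := (f.symm ⟨u, hu⟩).2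
          simp [hu, this] }
  have hev : e v = v := by simp [e]
  have he : ∀ u (hu : u ≠ v), e u = f ⟨u, hu⟩ := fun u hu => by simp [e, hu]
  let i : H.comap e ≃g H := Iso.comap e H
  have hi : ∀ u, i u = e u := fun u => rfl
  have hd : ∀ u, (H.comap e).deg u = G.deg (e u) := fun u => by
    rw [← hH.deg_eq hV, ← hi, i.deg_eq]
  obtain ⟨k⟩ := h (H.comap e) (fun a b ha hb => by
      rw [comap_adj, he a ha, he b hb]
      exact f.map_adj_iff (v := ⟨a, ha⟩) (w := ⟨b, hb⟩)) (by rw [hd, hev]) (fun u hu => by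
    refine ⟨e u, by rw [he u hu]; exact (f ⟨u, hu⟩).2, hd u, fun p => ?_⟩
    rw [← hH.exists_adj_deg_iff hV]
    simp_rw [hd, ← hH.deg_eq hV]
    constructor
    · rintro ⟨x, hx, hp⟩
      exact ⟨e x, hx, hp⟩
    · rintro ⟨x, hx, hp⟩
      exact ⟨e.symm x, by simpa using hx, by simpa using hp⟩)
  exact ⟨k.trans i⟩

theorem SimpleGraph.eq_of_neighborSet_subset {V : Type*} [Finite V] {G H : SimpleGraph V} {v : V}
    (hadj : ∀ a b, a ≠ v → b ≠ v → (H.Adj a b ↔ G.Adj a b)) (hdeg : H.deg v = G.deg v)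
    (h : ∀ u, G.Adj v u → H.Adj v u) : G = H := by
  have e : G.neighborSet v = H.neighborSet v :=
    Set.eq_of_subset_of_ncard_le (fun u hu => h u hu) hdeg.le
  have e' : ∀ u, G.Adj v u ↔ H.Adj v u := fun u => Set.ext_iff.mp e u
  ext a b
  by_cases ha : a = v
  · rw [ha, e']
  by_cases hb : b = v
  · rw [hb, G.adj_comm, H.adj_comm, e']
  exact (hadj a b ha hb).symm

open Classical in
theorem SimpleGraph.deg_add_ite_of_extension {V : Type*} [Finite V] {G H : SimpleGraph V}
    {v : V} (hadj : ∀ a b, a ≠ v → b ≠ v → (H.Adj a b ↔ G.Adj a b)) {u : V} (hu : u ≠ v) :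
    H.deg u + (if G.Adj v u then 1 else 0) = G.deg u + (if H.Adj v u then 1 else 0) := by
  have e : H.induce {u | u ≠ v} = G.induce {u | u ≠ v} := by
    ext a b
    exact hadj a b a.2 b.2
  rw [← deg_induce_ne H v ⟨u, hu⟩, ← deg_induce_ne G v ⟨u, hu⟩, e]
  dsimp only
  omega

theorem SimpleGraph.deg_add_one_of_extension {V : Type*} [Finite V] {G H : SimpleGraph V}
    {v : V} (hadj : ∀ a b, a ≠ v → b ≠ v → (H.Adj a b ↔ G.Adj a b)) {u : V} (h : G.Adj v u) (h' : ¬ H.Adj v u) :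
    H.deg u + 1 = G.deg u := by
  simpa [h, h'] using deg_add_ite_of_extension hadj h.ne'

theorem SimpleGraph.deg_le_of_extension {V : Type*} [Finite V] {G H : SimpleGraph V}
    {v : V} (hadj : ∀ a b, a ≠ v → b ≠ v → (H.Adj a b ↔ G.Adj a b)) {u : V} (hu : u ≠ v) (h : ¬ G.Adj v u) :
    G.deg u ≤ H.deg u := by
  have := deg_add_ite_of_extension hadj hu
  rw [if_neg h] at this
  omega

theorem Reconstructible.of_deg_sub_one {V : Type*} [Fintype V] {G : SimpleGraph V}
    (hV : 3 ≤ Fintype.card V) (v : V)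
    (h : ∀ u, G.Adj v u → ∀ w, w ≠ v → G.deg u ≠ G.deg w + 1) : Reconstructible G := by
  refine .of_extension hV v fun H hadj hdeg hdeck => ?_
  suffices G = H from this ▸ ⟨Iso.refl⟩
  refine eq_of_neighborSet_subset hadj hdeg fun u hu => ?_
  by_contra hu'
  obtain ⟨w, hw, e, -⟩ := hdeck u hu.ne'
  exact h u hu w hw (by rw [← deg_add_one_of_extension hadj hu hu', e])

theorem Reconstructible.of_regular {V : Type*} [Fintype V] {G : SimpleGraph V}
    (hV : 3 ≤ Fintype.card V) {d : ℕ} (h : ∀ v, G.deg v = d) : Reconstructible G := by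
  have : Nonempty V := Fintype.card_pos_iff.mp (by omega)
  refine .of_deg_sub_one hV (Classical.arbitrary V) fun u _ w _ => ?_
  rw [h, h]
  omega

theorem Reconstructible.of_iso {V W : Type*} {G : SimpleGraph V} {G' : SimpleGraph W}
    (f : G ≃g G') (h : Reconstructible G) : Reconstructible G' := by
  intro H hH
  let i : H.comap f ≃g H := Iso.comap f.toEquiv H
  have ind {K : SimpleGraph V} {L : SimpleGraph W} (g : K ≃g L) (hg : ∀ v, g v = f v) (v : V) :
      Nonempty (K.induce {u | u ≠ v} ≃g L.induce {u | u ≠ f v}) :=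
    ⟨{ toEquiv := g.toEquiv.subtypeEquiv fun u => by simp [hg]
       map_rel_iff' := g.map_rel_iff' }⟩
  obtain ⟨k⟩ := h (H.comap f) fun v => by
    obtain ⟨a⟩ := ind f (fun _ => rfl) v
    obtain ⟨b⟩ := ind i (fun _ => rfl) v
    obtain ⟨c⟩ := hH (f v)
    exact ⟨(a.trans c).trans b.symm⟩
  exact ⟨(f.symm.trans k).trans i⟩

/-! ### Degrees in products, cycles and paths -/

namespace SimpleGraph

theorem deg_boxProd {V W : Type*} [Finite V] [Finite W] (G : SimpleGraph V) (H : SimpleGraph W)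
    (x : V × W) : (G.boxProd H).deg x = G.deg x.1 + H.deg x.2 := by
  have := Fintype.ofFinite V
  have := Fintype.ofFinite W
  classical
  rw [deg_eq_degree, deg_eq_degree, deg_eq_degree, degree_boxProd]

theorem deg_completeGraph {n : ℕ} (v : Fin n) : (completeGraph (Fin n)).deg v = n - 1 := by
  rw [deg_eq_card (s := Finset.univ.erase v) (by simp [eq_comm])]
  simp

theorem deg_cycleGraph {n : ℕ} (hn : 3 ≤ n) (v : Fin n) : (cycleGraph n).deg v = 2 := by
  obtain ⟨m, rfl⟩ := Nat.exists_eq_add_of_le' hn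
  rw [deg_eq_degree, cycleGraph_degree_three_le]

theorem card_neighborFinset_cycleGraph {n : ℕ} (hn : 3 ≤ n) (v : Fin n) :
    ((cycleGraph n).neighborFinset v).card = 2 := by
  rw [card_neighborFinset_eq_degree, ← deg_eq_degree, deg_cycleGraph hn]

theorem deg_pathGraph_end {n : ℕ} (hn : 2 ≤ n) {i : Fin n} (hi : i.val = 0 ∨ i.val + 1 = n) :
    (pathGraph n).deg i = 1 := by
  rcases hi with hi | hi
  · rw [deg_eq_card (s := {⟨1, by omega⟩}) (fun u => ?_), Finset.card_singleton]
    rw [pathGraph_adj, Finset.mem_singleton, Fin.ext_iff]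
    dsimp only
    omega
  · rw [deg_eq_card (s := {⟨n - 2, by omega⟩}) (fun u => ?_), Finset.card_singleton]
    rw [pathGraph_adj, Finset.mem_singleton, Fin.ext_iff]
    dsimp only
    omega

theorem deg_pathGraph_interior {n : ℕ} {i : Fin n} (hi : i.val ≠ 0) (hi' : i.val + 1 ≠ n) :
    (pathGraph n).deg i = 2 := by
  rw [deg_eq_card (s := {⟨i.val + 1, by omega⟩, ⟨i.val - 1, by omega⟩}) (fun u => ?_),
    Finset.card_pair]
  · rw [ne_eq, Fin.ext_iff]
    dsimp only
    omega
  · rw [pathGraph_adj, Finset.mem_insert, Finset.mem_singleton, Fin.ext_iff, Fin.ext_iff]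
    dsimp only
    omega

theorem deg_pathGraph {n : ℕ} (hn : 2 ≤ n) (i : Fin n) :
    (pathGraph n).deg i = if i.val = 0 ∨ i.val + 1 = n then 1 else 2 := by
  split_ifs with h
  · exact deg_pathGraph_end hn h
  · push Not at h
    exact deg_pathGraph_interior h.1 h.2

end SimpleGraph

open SimpleGraph

/-! ### Families settled by degrees alone -/

theorem reconstructible_cliqueGraph {n : ℕ} (hn : 3 ≤ n) : Reconstructible (cliqueGraph n) :=
  .of_regular (by simpa using hn) deg_completeGraph

theorem reconstructible_prismGraph {n : ℕ} (hn : 3 ≤ n) : Reconstructible (prismGraph n) := by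
  refine .of_regular (d := 3) (by simp; omega) fun v => ?_
  rw [prismGraph, deg_boxProd, deg_cycleGraph hn, deg_completeGraph]

theorem deg_bookGraph_hub {n : ℕ} (j : Fin 2) : (bookGraph n).deg (.inl 0, j) = n + 1 := by
  rw [bookGraph, deg_boxProd, deg_completeGraph,
    deg_eq_card (s := Finset.univ.map Function.Embedding.inr) (by simp)]
  simp

theorem deg_bookGraph_page {n : ℕ} (i : Fin n) (j : Fin 2) :
    (bookGraph n).deg (.inr i, j) = 2 := by
  rw [bookGraph, deg_boxProd, deg_completeGraph,
    deg_eq_card (s := Finset.univ.map Function.Embedding.inl) (by simp)]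
  simp

theorem reconstructible_bookGraph {n : ℕ} (hn : 3 ≤ n) : Reconstructible (bookGraph n) := by
  have key (x) : (bookGraph n).deg x = n + 1 ∨ (bookGraph n).deg x = 2 := by
    obtain ⟨x | x, j⟩ := x
    · rw [Fin.fin_one_eq_zero x]
      exact .inl (deg_bookGraph_hub j)
    · exact .inr (deg_bookGraph_page x j)
  refine .of_deg_sub_one (by simp; omega) (.inl 0, 0) fun u _ w _ => ?_
  have := key u
  have := key w
  omega

theorem gearGraph_adj_some {n : ℕ} (i j : Fin (2 * n)) :
    (gearGraph n).Adj (some i) (some j) ↔ (cycleGraph (2 * n)).Adj i j := by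
  simpa [gearGraph, SimpleGraph.map, Relation.map_apply] using Adj.ne

theorem gearGraph_adj_none {n : ℕ} (i : Fin (2 * n)) :
    (gearGraph n).Adj none (some i) ↔ Even i.val := by
  simp [gearGraph, SimpleGraph.map, Relation.map_apply]

theorem gearGraph_adj_none' {n : ℕ} (i : Fin (2 * n)) :
    (gearGraph n).Adj (some i) none ↔ Even i.val := by
  rw [adj_comm, gearGraph_adj_none]

theorem le_deg_gearGraph_none (n : ℕ) : n ≤ (gearGraph n).deg none := by
  rw [deg_eq_card (s := (Finset.univ.filter fun i : Fin (2 * n) => Even i.val).map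
    Function.Embedding.some) (fun u => by cases u <;> simp [gearGraph_adj_none]), Finset.card_map]
  have : Function.Injective (fun i : Fin n => (⟨2 * i.val, by omega⟩ : Fin (2 * n))) :=
    fun i j h => by simpa [Fin.ext_iff] using h
  conv_lhs => rw [← Fintype.card_fin n, ← Finset.card_univ, ← Finset.card_image_of_injective _ this]
  exact Finset.card_le_card fun u => by simp; rintro i rfl; simp

theorem deg_gearGraph_even {n : ℕ} (hn : 2 ≤ n) {i : Fin (2 * n)} (hi : Even i.val) :
    (gearGraph n).deg (some i) = 3 := by
  rw [deg_eq_card (s := Finset.cons none (((cycleGraph (2 * n)).neighborFinset i).map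
    Function.Embedding.some) (by simp))
    (fun u => by cases u <;> simp [gearGraph_adj_none', gearGraph_adj_some, hi]),
    Finset.card_cons, Finset.card_map, card_neighborFinset_cycleGraph (by omega)]

theorem deg_gearGraph_odd {n : ℕ} (hn : 2 ≤ n) {i : Fin (2 * n)} (hi : ¬ Even i.val) :
    (gearGraph n).deg (some i) = 2 := by
  rw [deg_eq_card (s := ((cycleGraph (2 * n)).neighborFinset i).map Function.Embedding.some)
    (fun u => by cases u <;> simp [gearGraph_adj_none', gearGraph_adj_some, hi]),
    Finset.card_map, card_neighborFinset_cycleGraph (by omega)]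

theorem reconstructible_gearGraph {n : ℕ} (hn : 5 ≤ n) : Reconstructible (gearGraph n) := by
  have hc := le_deg_gearGraph_none n
  -- The neighbors of an even rim vertex are the centre and odd rim vertices, of degree 2. No vertex
  -- has degree 1, and the centre has degree at least 5, so lowering it by one misses 2 and 3.
  refine .of_deg_sub_one (by simp; omega) (some ⟨0, by omega⟩) fun u hu w _ => ?_
  have hw : (gearGraph n).deg w = 2 ∨ (gearGraph n).deg w = 3 ∨
      (gearGraph n).deg w = (gearGraph n).deg none := by
    rcases w with _ | i
    · simp
    by_cases hi : Even i.val
    · simp [deg_gearGraph_even (by omega) hi]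
    · simp [deg_gearGraph_odd (by omega) hi]
  rcases u with _ | i
  · omega
  · have hi : ¬ Even i.val := by
      rw [gearGraph_adj_some, cycleGraph_adj'] at hu
      simp only [Fin.sub_def] at hu
      rw [Nat.even_iff]
      have := i.2
      rcases hu with hu | hu
      · rcases Nat.eq_zero_or_pos i.val with h | h
        · simp [h] at hu
        · rw [Nat.mod_eq_of_lt (by omega)] at hu
          omega
      · rw [show 2 * n - 0 + i.val = i.val + 2 * n by omega, Nat.add_mod_right,
          Nat.mod_eq_of_lt this] at hu
        omega
    rw [deg_gearGraph_odd (by omega) hi]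
    omega

theorem reconstructible_antiprismGraph {n : ℕ} (hn : 3 ≤ n) :
    Reconstructible (antiprismGraph n) := by
  obtain ⟨m, rfl⟩ := Nat.exists_eq_add_of_le' hn
  have hs (i j : Fin (m + 3)) : j.val = (i.val + 1) % (m + 3) ↔ j = i + 1 := by
    rw [Fin.ext_iff, Fin.val_add, Fin.val_one]
  refine .of_regular (d := 4) (by simp; omega) fun v => ?_
  rcases v with i | i
  · rw [deg_eq_card (s := ((cycleGraph (m + 3)).neighborFinset i).disjSum {i, i + 1}) (fun u => ?_),
      Finset.card_disjSum, card_neighborFinset_cycleGraph (by omega), Finset.card_pair (by simp)]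
    rcases u with j | j <;> simp [antiprismGraph, hs, ← Fin.ext_iff]
  · rw [deg_eq_card (s := Finset.disjSum {i, i - 1} ((cycleGraph (m + 3)).neighborFinset i))
      (fun u => ?_), Finset.card_disjSum, card_neighborFinset_cycleGraph (by omega),
      Finset.card_pair (by simp [eq_sub_iff_add_eq])]
    rcases u with j | j <;>
      simp [antiprismGraph, hs, ← Fin.ext_iff, eq_sub_iff_add_eq, eq_comm (a := i)]

theorem reconstructible_mobiusGraph {n : ℕ} (hn : 2 ≤ n) : Reconstructible (mobiusGraph n) := by
  refine .of_regular (d := 3) (by simp; omega) fun i => ?_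
  have hlt := i.2
  -- The antipode of `i`; for `n ≥ 2` it is not a neighbor on the cycle, so it contributes a third
  -- neighbor.
  let o : Fin (2 * n) := ⟨if i.val < n then i.val + n else i.val - n, by split_ifs <;> omega⟩
  have ho : ∀ j, j = o ↔ i ≠ j ∧ (j.val = i.val + n ∨ i.val = j.val + n) := fun j => by
    rw [ne_eq, Fin.ext_iff, Fin.ext_iff]
    dsimp only [o]
    split_ifs <;> omega
  have hno : ¬ (cycleGraph (2 * n)).Adj i o := by
    rw [cycleGraph_adj', Fin.sub_def, Fin.sub_def]
    dsimp only [o]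
    split_ifs with h
    · rw [show 2 * n - (i.val + n) + i.val = n by omega,
        show 2 * n - i.val + (i.val + n) = n + 2 * n by omega, Nat.add_mod_right,
        Nat.mod_eq_of_lt (by omega)]
      omega
    · rw [show 2 * n - (i.val - n) + i.val = n + 2 * n by omega,
        show 2 * n - i.val + (i.val - n) = n by omega, Nat.add_mod_right,
        Nat.mod_eq_of_lt (by omega)]
      omega
  rw [deg_eq_card (s := Finset.cons o ((cycleGraph (2 * n)).neighborFinset i) (by simpa using hno))
    (fun u => ?_), Finset.card_cons, card_neighborFinset_cycleGraph (by omega)]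
  rw [Finset.mem_cons, ho, mem_neighborFinset, or_comm]
  simp [mobiusGraph]

theorem reconstructible_crossedPrismGraph {n : ℕ} (hn : 2 ≤ n) :
    Reconstructible (crossedPrismGraph n) := by
  refine .of_regular (d := 3) (by simp; omega) fun v => ?_
  let o (i : Fin (2 * n)) : Fin (2 * n) :=
    ⟨if i.val % 2 = 0 then i.val + 1 else i.val - 1, by split_ifs <;> omega⟩
  have ho (i j : Fin (2 * n)) : (∃ k : ℕ, (i.val = 2 * k ∧ j.val = 2 * k + 1) ∨
      (i.val = 2 * k + 1 ∧ j.val = 2 * k)) ↔ j = o i := by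
    rw [Fin.ext_iff]
    dsimp only [o]
    constructor
    · rintro ⟨k, h⟩
      split_ifs <;> omega
    · intro h
      refine ⟨i.val / 2, ?_⟩
      split_ifs at h <;> omega
  have ho' (i j : Fin (2 * n)) : i = o j ↔ j = o i := by
    simp only [Fin.ext_iff, o]
    split_ifs <;> omega
  rcases v with i | i
  · rw [deg_eq_card (s := ((cycleGraph (2 * n)).neighborFinset i).disjSum {o i}) (fun u => ?_),
      Finset.card_disjSum, card_neighborFinset_cycleGraph (by omega), Finset.card_singleton]
    rcases u with j | j <;> simp [crossedPrismGraph, ho]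
  · rw [deg_eq_card (s := Finset.disjSum {o i} ((cycleGraph (2 * n)).neighborFinset i))
      (fun u => ?_), Finset.card_disjSum, card_neighborFinset_cycleGraph (by omega),
      Finset.card_singleton]
    rcases u with j | j <;> simp [crossedPrismGraph, ho, ho' i]

/-! ### Paths, ladders and grids -/

theorem reconstructible_pathGraph {n : ℕ} (hn : 3 ≤ n) : Reconstructible (pathGraph n) := by
  obtain ⟨m, rfl⟩ := Nat.exists_eq_add_of_le' hn
  refine .of_extension (by simp) 0 fun H hadj hdeg hdeck => ?_
  rw [deg_pathGraph_end (by omega) (by simp), deg, Set.ncard_eq_one] at hdeg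
  obtain ⟨u, hu⟩ := hdeg
  have hu (x) : H.Adj 0 x ↔ x = u := Set.ext_iff.mp hu x
  have hu0 : u ≠ 0 := ((hu u).mpr rfl).ne'
  have hu0' : u.val ≠ 0 := Fin.val_ne_of_ne hu0
  by_cases h1 : u.val = 1
  · suffices pathGraph (m + 3) = H from this ▸ ⟨Iso.refl⟩
    refine eq_of_neighborSet_subset hadj (v := 0) ?_ fun x hx => ?_
    · rw [deg_pathGraph_end (by omega) (by simp), deg_eq_card (s := {u}) (by simpa using hu)]
      rfl
    · rw [hu, Fin.ext_iff]
      simp only [pathGraph_adj, Fin.val_zero] at hx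
      omega
  -- Attaching `0` to an interior vertex other than `1` would create degree 3.
  have hlast : u.val = m + 2 := by
    by_contra hne
    have h2 := deg_add_ite_of_extension hadj hu0
    rw [if_neg (by simp only [pathGraph_adj, Fin.val_zero]; omega), if_pos ((hu u).mpr rfl),
      deg_pathGraph_interior hu0' (by omega)] at h2
    obtain ⟨w, -, hw, -⟩ := hdeck u hu0
    rw [deg_pathGraph (by omega)] at hw
    split_ifs at hw <;> omega
  -- Negation modulo `m + 3` fixes `0` and reverses the remaining path.
  refine ⟨⟨Equiv.neg _, fun {a b} => ?_⟩⟩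
  have hneg (a : Fin (m + 3)) (ha : a ≠ 0) : (-a).val = m + 3 - a.val := by
    rw [Fin.val_neg, if_neg ha]
  simp only [Equiv.neg_apply]
  by_cases ha : a = 0
  · subst ha
    rw [neg_zero, hu, pathGraph_adj, Fin.ext_iff, hlast, Fin.val_neg]
    split_ifs with hb
    · subst hb
      simp
    · simp
      omega
  by_cases hb : b = 0
  · subst hb
    rw [neg_zero, adj_comm, hu, pathGraph_adj, Fin.ext_iff, hlast, hneg a ha]
    simp
    omega
  rw [hadj _ _ (by simpa using ha) (by simpa using hb), pathGraph_adj, pathGraph_adj, hneg a ha,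
    hneg b hb]
  have := Fin.val_ne_of_ne ha
  have := Fin.val_ne_of_ne hb
  omega

theorem deg_ladderGraph {n : ℕ} (hn : 2 ≤ n) (x : Fin n × Fin 2) :
    (ladderGraph n).deg x = if x.1.val = 0 ∨ x.1.val + 1 = n then 2 else 3 := by
  rw [ladderGraph, deg_boxProd, deg_completeGraph, deg_pathGraph hn]
  split_ifs <;> rfl

theorem ladderGraph_adj {n : ℕ} (x y : Fin n × Fin 2) : (ladderGraph n).Adj x y ↔
    ((x.1.val + 1 = y.1.val ∨ y.1.val + 1 = x.1.val) ∧ x.2.val = y.2.val) ∨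
    (x.2.val ≠ y.2.val ∧ x.1.val = y.1.val) := by
  rw [ladderGraph, boxProd_adj, pathGraph_adj, completeGraph, top_adj, ne_eq, Fin.ext_iff,
    Fin.ext_iff]

theorem reconstructible_ladderGraph {n : ℕ} (hn : 4 ≤ n) : Reconstructible (ladderGraph n) := by
  let v : Fin n × Fin 2 := (⟨0, by omega⟩, 0)
  have hv (x) : x ≠ v ↔ ¬ (x.1.val = 0 ∧ x.2.val = 0) := by
    rw [ne_eq, Prod.ext_iff, Fin.ext_iff, Fin.ext_iff]
    rfl
  have hvadj (x) : (ladderGraph n).Adj v x ↔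
      (x.1.val = 1 ∧ x.2.val = 0) ∨ (x.1.val = 0 ∧ x.2.val = 1) := by
    rw [ladderGraph_adj]
    change ((0 + 1 = _ ∨ _ + 1 = 0) ∧ 0 = _) ∨ (0 ≠ _ ∧ 0 = _) ↔ _
    omega
  refine .of_extension (by simp; omega) v fun H hadj hdeg hdeck => ?_
  suffices ladderGraph n = H from this ▸ ⟨Iso.refl⟩
  refine eq_of_neighborSet_subset hadj hdeg fun u hu => ?_
  by_contra hu'
  obtain ⟨w, hw, hd, hp⟩ := hdeck u hu.ne'
  have e := deg_add_one_of_extension hadj hu hu'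
  have hu1 := (hvadj u).mp hu
  rw [deg_ladderGraph (by omega)] at hd e
  have hwc : w.1.val = 0 ∨ w.1.val + 1 = n := by
    split_ifs at hd e <;> omega
  have hu0 : u.1.val = 1 ∧ u.2.val = 0 := by
    split_ifs at hd e <;> omega
  obtain ⟨j, hj⟩ := exists_ne w.2
  -- A corner `w` has the other corner of its rung as a neighbor of degree 2, so `u` needs such a
  -- neighbor in `H`. But its neighbors there have degree at least 3, as `n ≥ 4`.
  obtain ⟨x, hx, hx'⟩ := (hp (· ≤ 2)).mpr ⟨(w.1, j), by
    rw [ladderGraph_adj]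
    exact .inr ⟨Fin.val_ne_of_ne hj.symm, rfl⟩, by rw [deg_ladderGraph (by omega), if_pos hwc]⟩
  have hxv : x ≠ v := fun h => hu' (h ▸ hx).symm
  have hux := (hadj _ _ hu.ne' hxv).mp hx
  rw [ladderGraph_adj] at hux
  have hxv' := (hv x).mp hxv
  have := deg_le_of_extension hadj hxv (by rw [hvadj]; omega)
  rw [deg_ladderGraph (by omega), if_neg (by omega)] at this
  omega

theorem deg_gridGraph {n₁ n₂ : ℕ} (h₁ : 2 ≤ n₁) (h₂ : 2 ≤ n₂) (x : Fin n₁ × Fin n₂) :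
    (gridGraph n₁ n₂).deg x = (if x.1.val = 0 ∨ x.1.val + 1 = n₁ then 1 else 2) +
      (if x.2.val = 0 ∨ x.2.val + 1 = n₂ then 1 else 2) := by
  rw [gridGraph, deg_boxProd, deg_pathGraph h₁, deg_pathGraph h₂]

theorem gridGraph_adj {n₁ n₂ : ℕ} (x y : Fin n₁ × Fin n₂) : (gridGraph n₁ n₂).Adj x y ↔
    ((x.1.val + 1 = y.1.val ∨ y.1.val + 1 = x.1.val) ∧ x.2.val = y.2.val) ∨
    ((x.2.val + 1 = y.2.val ∨ y.2.val + 1 = x.2.val) ∧ x.1.val = y.1.val) := by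
  rw [gridGraph, boxProd_adj, pathGraph_adj, pathGraph_adj, Fin.ext_iff, Fin.ext_iff]

theorem reconstructible_gridGraph_of_three_le {n₁ n₂ : ℕ} (h₁ : 3 ≤ n₁) (h₂ : 3 ≤ n₂) :
    Reconstructible (gridGraph n₁ n₂) := by
  refine .of_extension (by simp; nlinarith) (⟨0, by omega⟩, ⟨0, by omega⟩)
    fun H hadj hdeg hdeck => ?_
  suffices gridGraph n₁ n₂ = H from this ▸ ⟨Iso.refl⟩
  refine eq_of_neighborSet_subset hadj hdeg fun u hu => ?_
  by_contra hu'
  obtain ⟨w, hw, hd, hp⟩ := hdeck u hu.ne'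
  have e := deg_add_one_of_extension hadj hu hu'
  have hu1 : (u.1.val = 1 ∧ u.2.val = 0) ∨ (u.1.val = 0 ∧ u.2.val = 1) := by
    simp only [gridGraph_adj] at hu
    omega
  rw [deg_gridGraph (by omega) (by omega)] at hd e
  have hwc : (w.1.val = 0 ∨ w.1.val + 1 = n₁) ∧ (w.2.val = 0 ∨ w.2.val + 1 = n₂) := by
    split_ifs at hd e <;> omega
  -- This interior vertex is adjacent to `u` and has degree at least 4 in `H`, whereas neighbors of
  -- the corner `w` have degree at most 3.
  let x : Fin n₁ × Fin n₂ := (⟨1, by omega⟩, ⟨1, by omega⟩)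
  have hxv : x ≠ (⟨0, by omega⟩, ⟨0, by omega⟩) := by simp [x]
  have hux : H.Adj u x := by
    rw [hadj _ _ hu.ne' hxv, gridGraph_adj]
    dsimp only [x]
    omega
  have hx := deg_le_of_extension hadj hxv (by simp [x, gridGraph_adj])
  rw [deg_gridGraph (by omega) (by omega), if_neg (by dsimp only [x]; omega),
    if_neg (by dsimp only [x]; omega)] at hx
  obtain ⟨y, hy, hy'⟩ := (hp (4 ≤ ·)).mp ⟨x, hux, hx⟩
  rw [gridGraph_adj] at hy
  rw [deg_gridGraph (by omega) (by omega)] at hy'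
  split_ifs at hy' <;> omega

theorem reconstructible_gridGraph_one {n : ℕ} (hn : 3 ≤ n) : Reconstructible (gridGraph 1 n) :=
  (reconstructible_pathGraph hn).of_iso
    ⟨(Equiv.uniqueProd _ _).symm, by simp [gridGraph, Equiv.uniqueProd]⟩

theorem reconstructible_gridGraph_two {n : ℕ} (hn : 4 ≤ n) : Reconstructible (gridGraph n 2) := by
  have : gridGraph n 2 = ladderGraph n := by
    rw [gridGraph, pathGraph_two_eq_top]
    rfl
  exact this ▸ reconstructible_ladderGraph hn

theorem Reconstructible.gridGraph_comm {n₁ n₂ : ℕ} (h : Reconstructible (gridGraph n₁ n₂)) :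
    Reconstructible (gridGraph n₂ n₁) :=
  h.of_iso (boxProdComm _ _)

theorem reconstructible_gridGraph {n₁ n₂ : ℕ} (h : 8 ≤ n₁ * n₂) :
    Reconstructible (gridGraph n₁ n₂) := by
  wlog hle : n₁ ≤ n₂ generalizing n₁ n₂
  · exact (this (by rwa [mul_comm]) (by omega)).gridGraph_comm
  -- The bound 8 is what makes the longer side at least 4 when the shorter is 2.
  rcases Nat.lt_or_ge n₁ 3 with h₁ | h₁
  · interval_cases n₁
    · omega
    · exact reconstructible_gridGraph_one (by omega)
    · exact (reconstructible_gridGraph_two (by omega)).gridGraph_comm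
  · exact reconstructible_gridGraph_of_three_le h₁ (by omega)

theorem mainTheorem7 :
    (∃ N : ℕ, ∀ n ≥ N, Reconstructible (cliqueGraph n)) ∧
    (∃ N : ℕ, ∀ n ≥ N, Reconstructible (ladderGraph n)) ∧
    (∃ N : ℕ, ∀ n ≥ N, Reconstructible (bookGraph n)) ∧
    (∃ N : ℕ, ∀ n ≥ N, Reconstructible (gearGraph n)) ∧
    (∃ N : ℕ, ∀ n ≥ N, Reconstructible (prismGraph n)) ∧
    (∃ N : ℕ, ∀ n ≥ N, Reconstructible (antiprismGraph n)) ∧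
    (∃ N : ℕ, ∀ n ≥ N, Reconstructible (mobiusGraph n)) ∧
    (∃ N : ℕ, ∀ n ≥ N, Reconstructible (crossedPrismGraph n)) ∧
    (∃ N : ℕ, ∀ n₁ n₂ : ℕ, n₁ * n₂ ≥ N → Reconstructible (gridGraph n₁ n₂)) :=
  ⟨⟨3, fun _ => reconstructible_cliqueGraph⟩, ⟨4, fun _ => reconstructible_ladderGraph⟩,
    ⟨3, fun _ => reconstructible_bookGraph⟩, ⟨5, fun _ => reconstructible_gearGraph⟩,
    ⟨3, fun _ => reconstructible_prismGraph⟩, ⟨3, fun _ => reconstructible_antiprismGraph⟩,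
    ⟨2, fun _ => reconstructible_mobiusGraph⟩, ⟨2, fun _ => reconstructible_crossedPrismGraph⟩,
    ⟨8, fun _ _ => reconstructible_gridGraph⟩⟩
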